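/- Let $n\ge 1$ and let $E_1,\ldots,E_n$ be (real) Banach lattices, all but at most one of which have the weak Dunford--Pettis property (a Banach lattice $E$ has this property if every weakly compact operator from $E$ into any Banach space maps weakly null sequences of pairwise disjoint vectors of $E$ to norm null sequences). For each $i=1,\ldots,n$ let $(x^i_j)_{j=1}^\infty$ be a weakly null sequence of positive vectors in $E_i$. Then the sequence $(x^1_j\otimes\cdots\otimes x^n_j)_{j=1}^\infty$ is weakly null in the Fremlin positive projective tensor product $E_1\widehat{\otimes}_{|\pi|}\cdots\widehat{\otimes}_{|\pi|}E_n$, that is, in the completion of Fremlin's Archimedean Riesz space tensor product $E_1\bar\otimes\cdots\bar\otimes E_n$ (the Archimedean Riesz space that is universal for lattice $n$-morphisms $E_1\times\cdots\times E_n\to G$ into Archimedean Riesz spaces $G$) with respect to the norm $$\|w\|_{|\pi|}=\inf\Big\{\sum_{k=1}^m\|x_{1,k}\|\cdots\|x_{n,k}\| : m\in\mathbb{N},\ 0\le x_{i,k}\in E_i,\ |w|\le\sum_{k=1}^m x_{1,k}\otimes\cdots\otimes x_{n,k}\Big\}.$$ -/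

import Mathlib

open Filter Topology

universe u

set_option linter.unusedSectionVars false
set_option linter.unusedVariables false

noncomputable section

/-- A sequence in a real normed space is weakly null if it converges to `0` in the weak topology,
i.e. every continuous linear functional maps it to a null sequence. -/
def WeaklyNull {X : Type*} [NormedAddCommGroup X] [NormedSpace ℝ X] (x : ℕ → X) : Prop :=
  ∀ f : StrongDual ℝ X, Tendsto (fun j => f (x j)) atTop (𝓝 0)

/-- A bounded operator is weakly compact if it maps the closed unit ball to a relatively weakly
compact set. -/
def IsWeaklyCompactOperator {X Y : Type*} [NormedAddCommGroup X] [NormedSpace ℝ X]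
    [NormedAddCommGroup Y] [NormedSpace ℝ Y] (T : X →L[ℝ] Y) : Prop :=
  IsCompact (closure (toWeakSpace ℝ Y '' (T '' Metric.closedBall (0 : X) 1)))

/-- The weak Dunford-Pettis property of a Banach lattice: every weakly compact operator into a
Banach space maps weakly null sequences of pairwise disjoint vectors to norm null sequences.
(Target spaces in the universe of `E` suffice: one can replace a target by the closure of the
range.) -/
def WeakDunfordPettis (E : Type u) [NormedAddCommGroup E] [NormedSpace ℝ E] [Lattice E] : Prop :=
  ∀ (Y : Type u) [NormedAddCommGroup Y] [NormedSpace ℝ Y] [CompleteSpace Y] (T : E →L[ℝ] Y),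
    IsWeaklyCompactOperator T →
      ∀ x : ℕ → E, WeaklyNull x → (∀ j k, j ≠ k → |x j| ⊓ |x k| = 0) →
        Tendsto (fun j => T (x j)) atTop (𝓝 0)

section RieszTensor

variable {ι : Type} (E : ι → Type u) [∀ i, NormedAddCommGroup (E i)] [∀ i, NormedSpace ℝ (E i)]
  [∀ i, Lattice (E i)]

/-- A lattice multimorphism from `∏ i, E i` into an Archimedean Riesz space `G`: a multilinear map
`φ` with `|φ (x₁, …, xₙ)| = φ (|x₁|, …, |xₙ|)`. -/
structure LatticeMultimorphism where
  G : Type u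
  [addCommGroup : AddCommGroup G]
  [lattice : Lattice G]
  [isOrderedAddMonoid : IsOrderedAddMonoid G]
  [module : Module ℝ G]
  [isOrderedModule : IsOrderedModule ℝ G]
  archimedean : ∀ x y : G, (∀ k : ℕ, k • x ≤ y) → x ≤ 0
  map : MultilinearMap ℝ E G
  abs_map : ∀ x, |map x| = map fun i => |x i|

attribute [instance] LatticeMultimorphism.addCommGroup LatticeMultimorphism.lattice
  LatticeMultimorphism.isOrderedAddMonoid LatticeMultimorphism.module
  LatticeMultimorphism.isOrderedModule

/-- The family of the values of all lattice multimorphisms at `x`. -/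
def universalTensor (x : ∀ i, E i) : ∀ φ : LatticeMultimorphism E, φ.G := fun φ => φ.map x

/-- The linear sublattice generated by the elementary tensors. -/
def rieszSpan : Submodule ℝ (∀ φ : LatticeMultimorphism E, φ.G) :=
  sInf {S | (∀ x, universalTensor E x ∈ S) ∧ ∀ a ∈ S, ∀ b ∈ S, a ⊔ b ∈ S}

variable {E}

theorem universalTensor_mem (x : ∀ i, E i) : universalTensor E x ∈ rieszSpan E :=
  Submodule.mem_sInf.2 fun _ hS => hS.1 x

theorem rieszSpan_sup {a b : ∀ φ : LatticeMultimorphism E, φ.G} (ha : a ∈ rieszSpan E)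
    (hb : b ∈ rieszSpan E) : a ⊔ b ∈ rieszSpan E :=
  Submodule.mem_sInf.2 fun S hS =>
    hS.2 a (Submodule.mem_sInf.1 ha S hS) b (Submodule.mem_sInf.1 hb S hS)

theorem rieszSpan_inf {a b : ∀ φ : LatticeMultimorphism E, φ.G} (ha : a ∈ rieszSpan E)
    (hb : b ∈ rieszSpan E) : a ⊓ b ∈ rieszSpan E := by
  have h := neg_mem (rieszSpan_sup (neg_mem ha) (neg_mem hb))
  rwa [neg_sup, neg_neg, neg_neg] at h

variable (E)

/-- Fremlin's Archimedean Riesz space tensor product `E₁ ⊗̄ ⋯ ⊗̄ Eₙ`. It is generated as a Riesz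
space by the elementary tensors, and every lattice multimorphism into an Archimedean Riesz space
(in the universe of the `E i`, which is large enough to contain a copy of the tensor product)
factors through it by a unique Riesz homomorphism, namely a coordinate projection. -/
def RieszTensor : Type (u + 1) := rieszSpan E

namespace RieszTensor

instance : AddCommGroup (RieszTensor E) := inferInstanceAs (AddCommGroup (rieszSpan E))

instance : Module ℝ (RieszTensor E) := inferInstanceAs (Module ℝ (rieszSpan E))

instance : Lattice (RieszTensor E) :=
  Subtype.lattice (P := fun a => a ∈ rieszSpan E) (fun _ _ ha hb => rieszSpan_sup ha hb)
    (fun _ _ ha hb => rieszSpan_inf ha hb)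

variable {E}

theorem le_def {a b : RieszTensor E} : a ≤ b ↔ a.1 ≤ b.1 := Iff.rfl

instance : IsOrderedAddMonoid (RieszTensor E) where
  add_le_add_left a b h c := add_le_add_left (α := ∀ φ : LatticeMultimorphism E, φ.G) h c.1

instance : IsOrderedModule ℝ (RieszTensor E) where
  smul_le_smul_of_nonneg_left c hc a b h := fun φ => smul_le_smul_of_nonneg_left (h φ) hc
  smul_le_smul_of_nonneg_right b hb c d h := fun φ => smul_le_smul_of_nonneg_right h (hb φ)

/-- The elementary tensor `x₁ ⊗ ⋯ ⊗ xₙ`. -/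
def tmul (x : ∀ i, E i) : RieszTensor E := ⟨universalTensor E x, universalTensor_mem x⟩

theorem abs_tmul (x : ∀ i, E i) : |tmul x| = tmul fun i => |x i| :=
  Subtype.ext (funext fun φ => φ.abs_map x)

theorem abs_smul_eq (c : ℝ) (a : RieszTensor E) : |c • a| = |c| • |a| := by
  have key : ∀ (d : ℝ), 0 ≤ d → |d • a| = d • |a| := by
    intro d hd
    rcases hd.eq_or_lt with rfl | hd
    · simp
    have h1 : ∀ (e : ℝ), 0 ≤ e → ∀ b : RieszTensor E, |e • b| ≤ e • |b| := by
      intro e he b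
      refine abs_le'.2 ⟨smul_le_smul_of_nonneg_left (le_abs_self b) he, ?_⟩
      rw [← smul_neg]
      exact smul_le_smul_of_nonneg_left (neg_le_abs b) he
    refine le_antisymm (h1 d hd.le a) ?_
    have h2 := smul_le_smul_of_nonneg_left (h1 d⁻¹ (inv_nonneg.2 hd.le) (d • a)) hd.le
    rwa [smul_smul, smul_smul, inv_mul_cancel₀ hd.ne', mul_inv_cancel₀ hd.ne', one_smul,
      one_smul] at h2
  rcases le_total 0 c with hc | hc
  · rw [key c hc, abs_of_nonneg hc]
  · rw [abs_of_nonpos hc, ← key (-c) (neg_nonneg.2 hc), neg_smul, abs_neg]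

variable [∀ i, IsOrderedAddMonoid (E i)] [Fintype ι]

/-- The numbers `∑ₖ ‖x₁ₖ‖ ⋯ ‖xₙₖ‖` over all finite families of positive vectors with
`|w| ≤ ∑ₖ x₁ₖ ⊗ ⋯ ⊗ xₙₖ`. -/
def dominatingSums (w : RieszTensor E) : Set ℝ :=
  {r | ∃ (m : ℕ) (x : Fin m → ∀ i, E i), (∀ k i, 0 ≤ x k i) ∧
    |w| ≤ ∑ k, tmul (x k) ∧ r = ∑ k, ∏ i, ‖x k i‖}

theorem nonneg_of_mem {w : RieszTensor E} {r : ℝ} (h : r ∈ dominatingSums w) : 0 ≤ r := by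
  obtain ⟨m, x, -, -, rfl⟩ := h
  positivity

theorem bddBelow (w : RieszTensor E) : BddBelow (dominatingSums w) :=
  ⟨0, fun _ h => nonneg_of_mem h⟩

theorem mem_mono {v w : RieszTensor E} (hvw : |v| ≤ |w|) {r : ℝ} (h : r ∈ dominatingSums w) :
    r ∈ dominatingSums v := by
  obtain ⟨m, x, h0, h1, h2⟩ := h
  exact ⟨m, x, h0, hvw.trans h1, h2⟩

theorem zero_mem : (0 : ℝ) ∈ dominatingSums (0 : RieszTensor E) :=
  ⟨0, Fin.elim0, fun k => k.elim0, by simp, by simp⟩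

theorem add_mem_of_le {u v w : RieszTensor E} (hw : |w| ≤ |u| + |v|) {r s : ℝ}
    (hr : r ∈ dominatingSums u) (hs : s ∈ dominatingSums v) : r + s ∈ dominatingSums w := by
  obtain ⟨m, x, h0, h1, rfl⟩ := hr
  obtain ⟨l, y, h0', h1', rfl⟩ := hs
  refine ⟨m + l, Fin.append x y, fun k => ?_, ?_, ?_⟩
  · refine Fin.addCases (fun k => ?_) (fun k => ?_) k
    · simpa using h0 k
    · simpa using h0' k
  · rw [Fin.sum_univ_add]
    simpa using hw.trans (add_le_add h1 h1')
  · rw [Fin.sum_univ_add]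
    simp

variable [Nonempty ι] [∀ i, IsOrderedModule ℝ (E i)] [∀ i, HasSolidNorm (E i)]

theorem smul_mem {w : RieszTensor E} (c : ℝ) {r : ℝ} (h : r ∈ dominatingSums w) :
    |c| * r ∈ dominatingSums (c • w) := by
  classical
  obtain ⟨m, x, h0, h1, rfl⟩ := h
  let i₀ : ι := Classical.arbitrary ι
  have hx : ∀ k, tmul (Function.update (x k) i₀ (|c| • x k i₀)) = |c| • tmul (x k) := by
    intro k
    refine Subtype.ext (funext fun φ => ?_)
    change φ.map _ = |c| • φ.map (x k)
    rw [φ.map.map_update_smul, Function.update_eq_self]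
  refine ⟨m, fun k => Function.update (x k) i₀ (|c| • x k i₀), fun k i => ?_, ?_, ?_⟩
  · by_cases hi : i = i₀
    · subst hi
      simpa using smul_nonneg (abs_nonneg c) (h0 k _)
    · simpa [Function.update_of_ne hi] using h0 k i
  · rw [abs_smul_eq, Finset.sum_congr rfl fun k _ => hx k, ← Finset.smul_sum]
    exact smul_le_smul_of_nonneg_left h1 (abs_nonneg c)
  · rw [Finset.mul_sum]
    refine Finset.sum_congr rfl fun k _ => ?_
    rw [← Finset.mul_prod_erase _ _ (Finset.mem_univ i₀),
      ← Finset.mul_prod_erase _ (fun i => ‖Function.update (x k) i₀ (|c| • x k i₀) i‖)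
        (Finset.mem_univ i₀), ← mul_assoc]
    congr 1
    · simp [norm_smul]
    · refine Finset.prod_congr rfl fun i hi => ?_
      rw [Function.update_of_ne (Finset.ne_of_mem_erase hi)]

theorem tmul_mem (x : ∀ i, E i) : ∏ i, ‖x i‖ ∈ dominatingSums (tmul x) :=
  ⟨1, fun _ i => |x i|, fun _ i => abs_nonneg _, by simp [abs_tmul], by simp [norm_abs_eq_norm]⟩

/-- Every element of the tensor product is dominated by a sum of positive elementary tensors. -/
theorem dominatingSums_nonempty (w : RieszTensor E) : (dominatingSums w).Nonempty := by
  let S : Submodule ℝ (∀ φ : LatticeMultimorphism E, φ.G) :=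
    { carrier := {a | ∃ h : a ∈ rieszSpan E, (dominatingSums (⟨a, h⟩ : RieszTensor E)).Nonempty}
      zero_mem' := ⟨ZeroMemClass.zero_mem _, 0, zero_mem⟩
      add_mem' := by
        rintro a b ⟨ha, r, hr⟩ ⟨hb, s, hs⟩
        exact ⟨add_mem ha hb, r + s, add_mem_of_le (abs_add_le _ _) hr hs⟩
      smul_mem' := by
        rintro c a ⟨ha, r, hr⟩
        exact ⟨Submodule.smul_mem _ c ha, |c| * r, smul_mem c hr⟩ }
  have hS : rieszSpan E ≤ S := by
    refine sInf_le ⟨fun x => ⟨universalTensor_mem x, _, tmul_mem x⟩, ?_⟩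
    rintro a ⟨ha, r, hr⟩ b ⟨hb, s, hs⟩
    refine ⟨rieszSpan_sup ha hb, r + s, add_mem_of_le ?_ hr hs⟩
    let a' : RieszTensor E := ⟨a, ha⟩
    let b' : RieszTensor E := ⟨b, hb⟩
    change |a' ⊔ b'| ≤ |a'| + |b'|
    refine abs_le'.2 ⟨sup_le ?_ ?_, ?_⟩
    · exact (le_abs_self a').trans (le_add_of_nonneg_right (abs_nonneg b'))
    · exact (le_abs_self b').trans (le_add_of_nonneg_left (abs_nonneg a'))
    · exact (neg_le_neg le_sup_left).trans
        ((neg_le_abs a').trans (le_add_of_nonneg_right (abs_nonneg b')))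
  exact (hS w.2).2

/-- The positive projective norm
`‖w‖ = inf {∑ₖ ‖x₁ₖ‖ ⋯ ‖xₙₖ‖ : xᵢₖ ≥ 0, |w| ≤ ∑ₖ x₁ₖ ⊗ ⋯ ⊗ xₙₖ}`. -/
def positiveProjectiveNorm (w : RieszTensor E) : ℝ := sInf (dominatingSums w)

theorem positiveProjectiveNorm_zero : positiveProjectiveNorm (0 : RieszTensor E) = 0 :=
  le_antisymm (csInf_le (bddBelow _) zero_mem) (Real.sInf_nonneg fun _ h => nonneg_of_mem h)

theorem positiveProjectiveNorm_smul_le (c : ℝ) (w : RieszTensor E) :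
    positiveProjectiveNorm (c • w) ≤ ‖c‖ * positiveProjectiveNorm w := by
  rw [positiveProjectiveNorm, positiveProjectiveNorm, Real.norm_eq_abs, ← smul_eq_mul,
    ← Real.sInf_smul_of_nonneg (abs_nonneg c)]
  refine le_csInf (dominatingSums_nonempty w).smul_set ?_
  rintro _ ⟨r, hr, rfl⟩
  exact csInf_le (bddBelow _) (smul_mem c hr)

theorem positiveProjectiveNorm_add_le (v w : RieszTensor E) :
    positiveProjectiveNorm (v + w) ≤ positiveProjectiveNorm v + positiveProjectiveNorm w := by
  refine le_of_forall_pos_le_add fun ε hε => ?_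
  obtain ⟨r, hr, hr'⟩ := Real.lt_sInf_add_pos (dominatingSums_nonempty v) (half_pos hε)
  obtain ⟨s, hs, hs'⟩ := Real.lt_sInf_add_pos (dominatingSums_nonempty w) (half_pos hε)
  have := csInf_le (bddBelow _) (add_mem_of_le (abs_add_le v w) hr hs)
  simp only [positiveProjectiveNorm] at *
  linarith

/-- The positive projective norm as a seminorm. -/
def positiveProjectiveSeminorm : Seminorm ℝ (RieszTensor E) :=
  Seminorm.ofSMulLE positiveProjectiveNorm positiveProjectiveNorm_zero
    positiveProjectiveNorm_add_le positiveProjectiveNorm_smul_le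

instance : SeminormedAddCommGroup (RieszTensor E) :=
  (positiveProjectiveSeminorm (E := E)).toAddGroupSeminorm.toSeminormedAddCommGroup

instance : NormedSpace ℝ (RieszTensor E) := ⟨positiveProjectiveNorm_smul_le⟩

theorem norm_def (w : RieszTensor E) : ‖w‖ = sInf (dominatingSums w) := rfl

end RieszTensor

variable [∀ i, IsOrderedAddMonoid (E i)] [Fintype ι] [Nonempty ι]
  [∀ i, IsOrderedModule ℝ (E i)] [∀ i, HasSolidNorm (E i)]

/-- The Fremlin positive projective tensor product `E₁ ⊗̂ ⋯ ⊗̂ Eₙ`: the completion of the Riesz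
space tensor product for the positive projective norm. -/
abbrev PositiveProjectiveTensor : Type (u + 1) := UniformSpace.Completion (RieszTensor E)

variable {E}

/-- The elementary tensor `x₁ ⊗ ⋯ ⊗ xₙ` in the Fremlin positive projective tensor product. -/
def PositiveProjectiveTensor.tmul (x : ∀ i, E i) : PositiveProjectiveTensor E :=
  ((RieszTensor.tmul x : RieszTensor E) : UniformSpace.Completion (RieszTensor E))

end RieszTensor

end

/-! On a seminormed Riesz space every continuous functional is dominated on the positive cone by a
positive one (`exists_dominating_functional`). Weak nullity of the tensors thus reduces to `A (x¹ⱼ,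
…, xⁿⱼ) → 0` for positive bounded multilinear forms `A`. Induct on the number of factors. Pick a
factor `E p` with the weak Dunford-Pettis property, and let `f j` be the positive functional on `E
p` obtained by filling the other slots with the `j`-th vectors. Dominating a bidual functional on
the cone of positive functionals gives a positive form in one variable fewer, so `f` is weakly null
by induction. It remains to see `f j (x j) → 0` on `E p`. For disjoint `x j`, weak nullity of `f`
makes `v ↦ (f j v)_j` a weakly compact operator into `c₀`, and the property applies. For general
positive `x j`, a subsequence is dominated by a disjoint sequence up to errors on which `f` tends to
zero. -/

open scoped ZeroAtInfty

/-! ### Domination of functionals on a cone -/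

/-- If `‖a - b‖ ≤ ‖a + b‖` on a cone, then every continuous functional is dominated on the cone by
another continuous functional. -/
theorem exists_dominating_functional {V : Type*} [SeminormedAddCommGroup V] [NormedSpace ℝ V]
    (K : PointedCone ℝ V) (hK : ∀ a ∈ K, ∀ b ∈ K, ‖a - b‖ ≤ ‖a + b‖) (φ : StrongDual ℝ V) :
    ∃ ψ : StrongDual ℝ V, ∀ a ∈ K, |φ a| ≤ ψ a := by
  -- Essentially the epigraph of the sublinear `v ↦ inf (‖φ‖ * ‖v + a + b‖ - φ a + φ b)` over `a, b
  -- ∈ K`. A linear minorant `ψ` of it satisfies `±φ ≤ ψ` on `K`; below, `ψ v = -g (v, 0)`.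
  let s : PointedCone ℝ (V × ℝ) :=
    { carrier := {p | ∃ a ∈ K, ∃ b ∈ K, ‖φ‖ * ‖p.1 + (a + b)‖ - φ a + φ b ≤ p.2}
      zero_mem' := ⟨0, zero_mem _, 0, zero_mem _, by simp⟩
      add_mem' := by
        rintro ⟨v, t⟩ ⟨v', t'⟩ ⟨a, ha, b, hb, h⟩ ⟨a', ha', b', hb', h'⟩
        refine ⟨a + a', add_mem ha ha', b + b', add_mem hb hb', ?_⟩
        have h1 : ‖v + v' + (a + a' + (b + b'))‖ ≤ ‖v + (a + b)‖ + ‖v' + (a' + b')‖ := by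
          refine le_of_eq_of_le ?_ (norm_add_le _ _)
          congr 1
          abel
        have h2 := mul_le_mul_of_nonneg_left h1 (norm_nonneg φ)
        simp only [Prod.fst_add, Prod.snd_add, map_add] at h h' ⊢
        linarith
      smul_mem' := by
        rintro ⟨c, hc⟩ ⟨v, t⟩ ⟨a, ha, b, hb, h⟩
        refine ⟨_, K.smul_mem hc ha, _, K.smul_mem hc hb, ?_⟩
        change ‖φ‖ * ‖c • v + (c • a + c • b)‖ - φ (c • a) + φ (c • b) ≤ c * t
        rw [← smul_add, ← smul_add, norm_smul, Real.norm_of_nonneg hc, map_smul, map_smul,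
          smul_eq_mul, smul_eq_mul]
        have := mul_le_mul_of_nonneg_left h hc
        simp only at this
        linarith }
  let D : V × ℝ →ₗ.[ℝ] ℝ :=
    ⟨LinearMap.ker (LinearMap.fst ℝ V ℝ), (LinearMap.snd ℝ V ℝ).comp (Submodule.subtype _)⟩
  obtain ⟨g, hg1, hg2⟩ := riesz_extension s D
    -- On the axis `v = 0` the claim is `φ (a - b) ≤ ‖φ‖ * ‖a + b‖`, which is where `hK` enters.
    (by
      rintro ⟨⟨v, t⟩, hv⟩ ⟨a, ha, b, hb, h⟩
      obtain rfl : v = 0 := hv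
      change 0 ≤ t
      have h1 := (le_abs_self _).trans (φ.le_opNorm (a - b))
      have h2 := mul_le_mul_of_nonneg_left (hK a ha b hb) (norm_nonneg φ)
      simp only [zero_add, map_sub] at h h1
      linarith)
    (by
      rintro ⟨v, t⟩
      refine ⟨⟨(0, ‖φ‖ * ‖v‖ - t), by simp [D]⟩, 0, zero_mem _, 0, zero_mem _, ?_⟩
      simp)
  have hsnd : ∀ t : ℝ, g (0, t) = t := fun t => hg1 ⟨(0, t), by simp [D]⟩
  have hsplit : ∀ v t, g (v, t) = g (v, 0) + t := fun v t => by
    rw [← hsnd t, ← map_add]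
    simp [hsnd]
  have hle : ∀ v, -g (v, 0) ≤ ‖φ‖ * ‖v‖ := fun v => by
    have := hg2 (v, ‖φ‖ * ‖v‖) ⟨0, zero_mem _, 0, zero_mem _, by simp⟩
    rw [hsplit] at this
    linarith
  refine ⟨(-(g.comp (LinearMap.inl ℝ V ℝ))).mkContinuous ‖φ‖ fun v => ?_, fun a ha => ?_⟩
  · have h1 := hle v
    have h2 := hle (-v)
    have h3 : g (-v, 0) = - g (v, 0) := by
      rw [← map_neg]
      simp
    rw [norm_neg] at h2
    exact abs_le.2 ⟨by simp; linarith, by simpa using h1⟩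
  · have h3 : g (-a, 0) = - g (a, 0) := by
      rw [← map_neg]
      simp
    have h1 := hg2 (-a, -φ a) ⟨a, ha, 0, zero_mem _, by simp⟩
    have h2 := hg2 (-a, φ a) ⟨0, zero_mem _, a, ha, by simp⟩
    rw [hsplit] at h1 h2
    refine abs_le.2 ⟨?_, ?_⟩ <;> simp <;> linarith

/-! ### Weakly null sequences -/

section Sequences

variable {X : Type*} [NormedAddCommGroup X] [NormedSpace ℝ X]

theorem WeaklyNull.comp {x : ℕ → X} (hx : WeaklyNull x) {n : ℕ → ℕ} (hn : Tendsto n atTop atTop) :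
    WeaklyNull (x ∘ n) :=
  fun f => (hx f).comp hn

theorem WeaklyNull.exists_norm_le {x : ℕ → X} (hx : WeaklyNull x) : ∃ C, ∀ j, ‖x j‖ ≤ C := by
  obtain ⟨C, hC⟩ := banach_steinhaus (g := fun j => NormedSpace.inclusionInDoubleDual ℝ X (x j))
    fun f => by
      obtain ⟨C, hC⟩ := (hx f).norm.bddAbove_range
      exact ⟨C, fun i => hC ⟨i, rfl⟩⟩
  exact ⟨C, fun j => by
    simpa using ((NormedSpace.inclusionInDoubleDualLi ℝ (E := X)).norm_map (x j)).symm.le.trans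
      (hC j)⟩

end Sequences

/-! ### Unit vectors and functionals of `c₀` -/

namespace ZeroAtInftyContinuousMap

variable {ι : Type*} [TopologicalSpace ι]

theorem abs_apply_le_norm (y : C₀(ι, ℝ)) (i : ι) : |y i| ≤ ‖y‖ := by
  rw [← norm_toBCF_eq_norm]
  exact y.toBCF.norm_coe_le_norm i

theorem norm_le_of_forall {y : C₀(ι, ℝ)} {C : ℝ} (hC : 0 ≤ C) (h : ∀ i, |y i| ≤ C) : ‖y‖ ≤ C := by
  rw [← norm_toBCF_eq_norm]
  exact (BoundedContinuousFunction.norm_le hC).2 h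

theorem sum_apply' {κ : Type*} (s : Finset κ) (f : κ → C₀(ι, ℝ)) (i : ι) :
    (∑ k ∈ s, f k) i = ∑ k ∈ s, f k i := by
  classical
  induction s using Finset.induction_on with
  | empty => simp
  | insert k s hk ih => simp [Finset.sum_insert hk, ih]

variable [DiscreteTopology ι]

/-- A null family as an element of `c₀`. -/
def ofTendsto (y : ι → ℝ) (hy : Tendsto y cofinite (𝓝 0)) : C₀(ι, ℝ) :=
  ⟨⟨y, continuous_of_discreteTopology⟩, by rwa [cocompact_eq_cofinite]⟩

open Classical in
/-- The unit vectors of `c₀`. -/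
noncomputable def unitVector (i : ι) : C₀(ι, ℝ) :=
  ofTendsto (Pi.single i 1) (tendsto_const_nhds.congr' <| by
    filter_upwards [(Set.finite_singleton i).compl_mem_cofinite] with j hj
    simp_all)

open Classical in
theorem sum_smul_unitVector_apply (s : Finset ι) (c : ι → ℝ) (i : ι) :
    (∑ k ∈ s, c k • unitVector k) i = if i ∈ s then c i else 0 := by
  rw [sum_apply']
  simp [unitVector, ofTendsto, Pi.single_apply]

theorem hasSum_smul_unitVector (y : C₀(ι, ℝ)) : HasSum (fun i => y i • unitVector i) y := by
  classical
  refine Metric.tendsto_atTop.2 fun ε hε => ?_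
  have h : {i | ¬ |y i| < ε / 2}.Finite := by
    have h1 : Tendsto y cofinite (𝓝 0) := by
      rw [← cocompact_eq_cofinite]
      exact y.zero_at_infty'
    have := h1.eventually (Metric.ball_mem_nhds 0 (half_pos hε))
    simpa [Filter.eventually_cofinite] using this
  refine ⟨h.toFinset, fun s hs => ?_⟩
  rw [dist_eq_norm]
  refine lt_of_le_of_lt (norm_le_of_forall (half_pos hε).le fun i => ?_) (half_lt_self hε)
  rw [sub_apply, sum_smul_unitVector_apply]
  split_ifs with hi
  · simpa using (half_pos hε).le
  · have : i ∉ h.toFinset := fun h => hi (hs h)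
    simp only [Set.Finite.mem_toFinset, Set.mem_ofPred_eq, not_not] at this
    simpa using this.le

/-- Testing `g` on finite sums of signed unit vectors, which have norm at most one, bounds the
partial sums by `‖g‖`. -/
theorem summable_abs_dual_unitVector (g : StrongDual ℝ C₀(ι, ℝ)) :
    Summable fun i => |g (unitVector i)| := by
  classical
  refine summable_of_sum_le (c := ‖g‖) (fun i => abs_nonneg _) fun s => ?_
  have h1 : ∑ i ∈ s, |g (unitVector i)| =
      g (∑ i ∈ s, (SignType.sign (g (unitVector i)) : ℝ) • unitVector i) := by
    rw [map_sum]
    refine Finset.sum_congr rfl fun i _ => ?_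
    rw [map_smul, smul_eq_mul, sign_mul_self]
  rw [h1]
  refine ((le_abs_self _).trans (g.le_opNorm _)).trans
    (mul_le_of_le_one_right (norm_nonneg g) (norm_le_of_forall zero_le_one fun i => ?_))
  rw [sum_smul_unitVector_apply]
  split_ifs
  · rcases lt_trichotomy (g (unitVector i)) 0 with h | h | h <;> simp [h]
  · simp

end ZeroAtInftyContinuousMap

/-! ### Weakly compact operators into `c₀` -/

section WeaklyCompact

open ZeroAtInftyContinuousMap

variable {E : Type u} [NormedAddCommGroup E] [NormedSpace ℝ E]

/-- Indexing by `ULift.{u} ℕ` puts `c₀` in the universe over which `WeakDunfordPettis` quantifies.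
-/
theorem WeaklyNull.tendsto_down {f : ℕ → E} (hf : WeaklyNull f) (φ : StrongDual ℝ E) :
    Tendsto (fun j : ULift.{u} ℕ => φ (f j.down)) cofinite (𝓝 0) :=
  (hf φ).comp (Nat.cofinite_eq_atTop ▸ ULift.down_injective.tendsto_cofinite)

/-- The map `φ ↦ (φ (f j))_j` from the bidual to `c₀` given by a weakly null sequence of
functionals. -/
noncomputable def coordinateMap {f : ℕ → StrongDual ℝ E} (hf : WeaklyNull f)
    (φ : StrongDual ℝ (StrongDual ℝ E)) : C₀(ULift.{u} ℕ, ℝ) :=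
  ofTendsto (fun j => φ (f j.down)) (hf.tendsto_down φ)

/-- Functionals on `c₀` have `ℓ¹` coefficients, so `h = ∑ g (e_j) • f j` converges. Hence
`coordinateMap` is weak*-to-weak continuous, and Banach-Alaoglu makes the image of the bidual ball
weakly compact. -/
theorem dual_coordinateMap {f : ℕ → StrongDual ℝ E} (hf : WeaklyNull f)
    (g : StrongDual ℝ C₀(ULift.{u} ℕ, ℝ)) :
    ∃ h : StrongDual ℝ E, ∀ φ, g (coordinateMap hf φ) = φ h := by
  obtain ⟨C, hC⟩ := hf.exists_norm_le
  have hs : Summable fun j : ULift.{u} ℕ => g (unitVector j) • f j.down := by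
    refine Summable.of_norm_bounded ((summable_abs_dual_unitVector g).mul_right C) fun j => ?_
    rw [norm_smul]
    exact mul_le_mul_of_nonneg_left (hC _) (norm_nonneg _)
  refine ⟨∑' j : ULift.{u} ℕ, g (unitVector j) • f j.down, fun φ => ?_⟩
  refine ((hasSum_smul_unitVector (coordinateMap hf φ)).mapL g).unique ?_
  convert hs.hasSum.mapL φ using 2 with j
  rw [map_smul, map_smul, smul_eq_mul, smul_eq_mul, mul_comm]
  rfl

theorem isCompact_coordinateMap_closedBall {f : ℕ → StrongDual ℝ E} (hf : WeaklyNull f) :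
    IsCompact (toWeakSpace ℝ C₀(ULift.{u} ℕ, ℝ) '' (coordinateMap hf '' Metric.closedBall 0 1)) := by
  have h := (WeakDual.isCompact_closedBall (𝕜 := ℝ) (0 : StrongDual ℝ (StrongDual ℝ E)) 1).image
    (f := fun φ => toWeakSpace ℝ C₀(ULift.{u} ℕ, ℝ) (coordinateMap hf (WeakDual.toStrongDual φ))) ?_
  · convert h using 1
    ext y
    simp only [Set.mem_image, Set.mem_preimage]
    constructor
    · rintro ⟨_, ⟨φ, hφ, rfl⟩, rfl⟩
      exact ⟨WeakDual.toStrongDual.symm φ, hφ, rfl⟩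
    · rintro ⟨φ, hφ, rfl⟩
      exact ⟨_, ⟨_, hφ, rfl⟩, rfl⟩
  · refine WeakBilin.continuous_of_continuous_eval _ fun g => ?_
    obtain ⟨h, hh⟩ := dual_coordinateMap hf g
    exact (WeakDual.eval_continuous h).congr fun φ => (hh _).symm

/-- The operator `x ↦ (f j x)_j` into `c₀` given by a weakly null sequence of functionals. -/
noncomputable def coordinateOperator {f : ℕ → StrongDual ℝ E} (hf : WeaklyNull f) : E →L[ℝ] C₀(ULift.{u} ℕ, ℝ) :=
  LinearMap.mkContinuousOfExistsBound
    { toFun := fun x => coordinateMap hf (NormedSpace.inclusionInDoubleDual ℝ E x)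
      map_add' := fun x y => by
        ext j
        exact map_add (f j.down) x y
      map_smul' := fun c x => by
        ext j
        exact map_smul (f j.down) c x }
    (by
      obtain ⟨C, hC⟩ := hf.exists_norm_le
      refine ⟨C, fun x => norm_le_of_forall ?_ fun j => ?_⟩
      · exact mul_nonneg ((norm_nonneg _).trans (hC 0)) (norm_nonneg x)
      · exact ((f j.down).le_opNorm x).trans (mul_le_mul_of_nonneg_right (hC _) (norm_nonneg x)))

theorem isWeaklyCompactOperator_coordinateOperator {f : ℕ → StrongDual ℝ E} (hf : WeaklyNull f) :
    IsWeaklyCompactOperator (coordinateOperator hf) := by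
  refine (isCompact_coordinateMap_closedBall hf).closure_of_subset (Set.image_mono ?_)
  rintro _ ⟨x, hx, rfl⟩
  refine ⟨NormedSpace.inclusionInDoubleDual ℝ E x, ?_, rfl⟩
  rw [mem_closedBall_zero_iff] at hx
  refine (mem_closedBall_zero_iff (E := StrongDual ℝ (StrongDual ℝ E))).2 ?_
  exact ((NormedSpace.inclusionInDoubleDualLi ℝ (E := E)).norm_map x).le.trans hx

theorem WeakDunfordPettis.tendsto_apply_of_disjoint [Lattice E] (hE : WeakDunfordPettis E)
    {f : ℕ → StrongDual ℝ E} (hf : WeaklyNull f) {x : ℕ → E} (hx : WeaklyNull x)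
    (hd : ∀ j k, j ≠ k → |x j| ⊓ |x k| = 0) : Tendsto (fun j => f j (x j)) atTop (𝓝 0) := by
  have h := hE _ (coordinateOperator hf) (isWeaklyCompactOperator_coordinateOperator hf) x hx hd
  refine squeeze_zero_norm (fun j => ?_) (tendsto_zero_iff_norm_tendsto_zero.1 h)
  exact abs_apply_le_norm (coordinateOperator hf (x j)) ⟨j⟩

end WeaklyCompact

/-! ### Disjointification in Banach lattices -/

section BanachLattice

variable {E : Type u} [NormedAddCommGroup E] [NormedSpace ℝ E] [Lattice E]
  [IsOrderedAddMonoid E] [IsOrderedModule ℝ E] [HasSolidNorm E]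

theorem norm_sub_le_norm_add_of_nonneg {a b : E} (ha : 0 ≤ a) (hb : 0 ≤ b) :
    ‖a - b‖ ≤ ‖a + b‖ := by
  refine HasSolidNorm.solid ?_
  rw [abs_of_nonneg (add_nonneg ha hb)]
  exact abs_le'.2 ⟨(sub_le_self a hb).trans (le_add_of_nonneg_right hb), by
    rw [neg_sub]
    exact (sub_le_self b ha).trans (le_add_of_nonneg_left ha)⟩

/-- A positive sequence dominated by a weakly null sequence is weakly null. -/
theorem WeaklyNull.of_nonneg_of_le {x y : ℕ → E} (hx : WeaklyNull x) (h0 : ∀ j, 0 ≤ y j)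
    (hy : ∀ j, y j ≤ x j) : WeaklyNull y := by
  intro φ
  obtain ⟨ψ, hψ⟩ := exists_dominating_functional (PointedCone.positive ℝ E)
    (fun a ha b hb => norm_sub_le_norm_add_of_nonneg (by simpa using ha) (by simpa using hb)) φ
  refine squeeze_zero_norm (fun j => (hψ (y j) (by simpa using h0 j)).trans ?_) (hx ψ)
  have := (abs_nonneg _).trans (hψ (x j - y j) (by simpa using hy j))
  rw [map_sub] at this
  linarith

/-- The cone of positive functionals. -/
def positiveFunctionals (E : Type u) [NormedAddCommGroup E] [NormedSpace ℝ E] [Lattice E] :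
    PointedCone ℝ (StrongDual ℝ E) where
  carrier := {g | ∀ x, 0 ≤ x → 0 ≤ g x}
  zero_mem' := fun _ _ => le_rfl
  add_mem' := fun hf hg x hx => add_nonneg (hf x hx) (hg x hx)
  smul_mem' := fun c _ hf x hx => mul_nonneg c.2 (hf x hx)

theorem norm_sub_le_norm_add_of_mem_positiveFunctionals {f g : StrongDual ℝ E}
    (hf : f ∈ positiveFunctionals E) (hg : g ∈ positiveFunctionals E) : ‖f - g‖ ≤ ‖f + g‖ := by
  have habs : ∀ h ∈ positiveFunctionals E, ∀ x, |h x| ≤ h |x| := fun h hh x => by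
    have h1 := hh _ (sub_nonneg.2 (le_abs_self x))
    have h2 := hh _ (sub_nonneg.2 (neg_le_abs x))
    rw [map_sub] at h1 h2
    rw [map_neg] at h2
    exact abs_le.2 ⟨by linarith, by linarith⟩
  refine ContinuousLinearMap.opNorm_le_bound _ (norm_nonneg _) fun x => ?_
  calc |f x - g x| ≤ |f x| + |g x| := abs_sub _ _
    _ ≤ f |x| + g |x| := add_le_add (habs f hf x) (habs g hg x)
    _ ≤ ‖f + g‖ * ‖|x|‖ := (le_abs_self _).trans ((f + g).le_opNorm |x|)
    _ = ‖f + g‖ * ‖x‖ := by rw [norm_abs_eq_norm]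

/-- The vectors `(x k - 2 ^ k ∑_{i < k} x i - z)⁺` are disjoint if `2 ^ (-i) x i ≤ z`. -/
theorem disjointification {x : ℕ → E} (hpos : ∀ j, 0 ≤ x j) {z : E} (hz : ∀ i, x i ≤ (2 : ℝ) ^ i • z)
    {y : ℕ → E} (hy : ∀ k, y k = (x k - (2 : ℝ) ^ k • ∑ i ∈ Finset.range k, x i - z)⁺) :
    ∀ j k, j ≠ k → |y j| ⊓ |y k| = 0 := by
  have hy0 : ∀ k, 0 ≤ y k := fun k => hy k ▸ posPart_nonneg _
  have hz0 : 0 ≤ z := by simpa using (hpos 0).trans (hz 0)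
  have key : ∀ k m, k < m → y k ⊓ y m = 0 := by
    intro k m hkm
    have hm : (0 : ℝ) < 2 ^ m := by positivity
    -- Multiples of `y k` and `y m` are bounded by the positive and negative parts of one vector,
    -- which are disjoint.
    have h1 : y m ≤ ((2 : ℝ) ^ m • x k - x m)⁻ := by
      rw [hy, ← posPart_neg, neg_sub]
      refine posPart_mono ?_
      refine (sub_le_self _ hz0).trans (sub_le_sub_left (smul_le_smul_of_nonneg_left ?_ hm.le) _)
      exact Finset.single_le_sum (fun i _ => hpos i) (Finset.mem_range.2 hkm)
    have h2 : y k ≤ ((2 : ℝ) ^ m • x k - x m)⁺ := by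
      have h3 : (2 : ℝ) ^ m • y k ≤ ((2 : ℝ) ^ m • x k - x m)⁺ := by
        rw [← le_inv_smul_iff_of_pos hm, hy]
        refine sup_le ?_ (smul_nonneg (by positivity) (posPart_nonneg _))
        rw [le_inv_smul_iff_of_pos hm]
        refine le_trans ?_ (le_posPart _)
        rw [smul_sub]
        refine sub_le_sub (smul_le_smul_of_nonneg_left (sub_le_self _ ?_) hm.le) (hz m)
        exact smul_nonneg (by positivity) (Finset.sum_nonneg fun i _ => hpos i)
      refine le_trans ?_ h3
      have := smul_le_smul_of_nonneg_right (one_le_pow₀ (M₀ := ℝ) one_le_two (n := m)) (hy0 k)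
      rwa [one_smul] at this
    exact le_antisymm ((inf_le_inf h2 h1).trans (posPart_inf_negPart_eq_zero _).le)
      (le_inf (hy0 k) (hy0 m))
  intro j k hjk
  rw [abs_of_nonneg (hy0 j), abs_of_nonneg (hy0 k)]
  rcases hjk.lt_or_gt with h | h
  · exact key j k h
  · rw [inf_comm]
    exact key k j h

theorem exists_strictMono_succ_of_eventually {P : ℕ → ℕ → Prop} (h : ∀ a, ∀ᶠ b in atTop, P a b) :
    ∃ n : ℕ → ℕ, StrictMono n ∧ ∀ k, P (n k) (n (k + 1)) := by
  choose g hg using fun a => ((h a).and (eventually_gt_atTop a)).exists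
  refine ⟨fun k => Nat.rec 0 (fun _ a => g a) k, strictMono_nat_of_lt_succ fun k => (hg _).2,
    fun k => (hg _).1⟩

variable [CompleteSpace E]

/-- Take `z = ∑ 2 ^ (-i) x i`: the sequence is bounded, and each term of a positive series is below
its sum. -/
theorem WeaklyNull.exists_le_two_pow_smul {x : ℕ → E} (hx : WeaklyNull x) (hpos : ∀ j, 0 ≤ x j) :
    ∃ z, ∀ i, x i ≤ (2 : ℝ) ^ i • z := by
  obtain ⟨C, hC⟩ := hx.exists_norm_le
  have hs : Summable fun i => ((1 / 2 : ℝ) ^ i) • x i := by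
    refine Summable.of_norm_bounded (summable_geometric_two.mul_right C) fun i => ?_
    rw [norm_smul, norm_pow, Real.norm_of_nonneg (by norm_num)]
    exact mul_le_mul_of_nonneg_left (hC i) (by positivity)
  refine ⟨∑' i, ((1 / 2 : ℝ) ^ i) • x i, fun i => ?_⟩
  have h := smul_le_smul_of_nonneg_left
    (hs.le_tsum i fun j _ => smul_nonneg (by positivity) (hpos j)) (by positivity : (0 : ℝ) ≤ 2 ^ i)
  rwa [smul_smul, ← mul_pow, show (2 : ℝ) * (1 / 2) = 1 by norm_num, one_pow, one_smul] at h

/-- On a Banach lattice with the weak Dunford-Pettis property, `f j (x j) → 0` for all positive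
weakly null sequences `x` of vectors and `f` of functionals. -/
theorem WeakDunfordPettis.tendsto_apply_of_nonneg (hE : WeakDunfordPettis E)
    {f : ℕ → StrongDual ℝ E} (hf : WeaklyNull f) (hf0 : ∀ j, f j ∈ positiveFunctionals E)
    {x : ℕ → E} (hx : WeaklyNull x) (hpos : ∀ j, 0 ≤ x j) :
    Tendsto (fun j => f j (x j)) atTop (𝓝 0) := by
  refine tendsto_of_subseq_tendsto fun ns hns => ?_
  have hf' : ∀ v, Tendsto (fun j => f (ns j) v) atTop (𝓝 0) := fun v =>
    (hf (NormedSpace.inclusionInDoubleDual ℝ E v)).comp hns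
  -- The sum runs over all indices up to `a`, not just the selected ones, so that the condition
  -- involves only two consecutive choices.
  obtain ⟨ms, hms, hsmall⟩ := exists_strictMono_succ_of_eventually
    (P := fun a b => f (ns b) ((2 : ℝ) ^ (a + 1) • ∑ i ∈ Finset.range (a + 1), x (ns i)) <
      1 / ((a : ℝ) + 1))
    fun a => (hf' _).eventually (gt_mem_nhds (by positivity))
  refine ⟨ms, ?_⟩
  have hlim : Tendsto (fun k => ns (ms k)) atTop atTop := hns.comp hms.tendsto_atTop
  have hX := hx.comp hlim
  have hF := hf.comp hlim
  obtain ⟨z, hz⟩ := hX.exists_le_two_pow_smul fun j => hpos _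
  let X : ℕ → E := fun k => x (ns (ms k))
  let y : ℕ → E := fun k => (X k - (2 : ℝ) ^ k • ∑ i ∈ Finset.range k, X i - z)⁺
  have hz0 : 0 ≤ z := by simpa using (hpos _).trans (hz 0)
  have hyX : ∀ k, y k ≤ X k := fun k => sup_le ((sub_le_self _ hz0).trans (sub_le_self _
    (smul_nonneg (by positivity) (Finset.sum_nonneg fun i _ => hpos _)))) (hpos _)
  have hlim1 : Tendsto (fun k => f (ns (ms k)) (y k)) atTop (𝓝 0) :=
    hE.tendsto_apply_of_disjoint hF (hX.of_nonneg_of_le (fun j => posPart_nonneg _) hyX)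
      (disjointification (fun j => hpos _) hz fun k => rfl)
  have hlim2 : Tendsto (fun k => f (ns (ms k)) z) atTop (𝓝 0) := (hf' z).comp hms.tendsto_atTop
  -- Since `X ≤ y + 2 ^ (k + 1) • ∑ + z` at index `k + 1`, three null sequences bound the value;
  -- `hsmall k` controls the middle one.
  rw [← tendsto_add_atTop_iff_nat 1] at hlim1 hlim2 ⊢
  have hsum := (hlim1.add (tendsto_one_div_add_atTop_nhds_zero_nat (𝕜 := ℝ))).add hlim2
  rw [add_zero, add_zero] at hsum
  refine squeeze_zero (fun k => hf0 _ _ (hpos _)) (fun k => ?_) hsum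
  have hmono : ∀ {a b : E}, a ≤ b → f (ns (ms (k + 1))) a ≤ f (ns (ms (k + 1))) b := fun hab => by
    simpa using hf0 (ns (ms (k + 1))) _ (sub_nonneg.2 hab)
  have h1 := hmono (le_posPart (X (k + 1) - (2 : ℝ) ^ (k + 1) • ∑ i ∈ Finset.range (k + 1), X i - z))
  rw [map_sub, map_sub] at h1
  have hk : k ≤ ms k := hms.le_apply
  have h2 : ∑ i ∈ Finset.range (k + 1), X i ≤ ∑ i ∈ Finset.range (ms k + 1), x (ns i) := by
    rw [← Finset.sum_image (f := fun i => x (ns i)) (g := ms) fun a _ b _ h => hms.injective h]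
    refine Finset.sum_le_sum_of_subset_of_nonneg ?_ fun i _ _ => hpos _
    intro i hi
    obtain ⟨j, hj, rfl⟩ := Finset.mem_image.1 hi
    exact Finset.mem_range.2 (Nat.lt_succ_of_le
      (hms.monotone (Nat.lt_succ_iff.1 (Finset.mem_range.1 hj))))
  have h3 : (2 : ℝ) ^ (k + 1) • ∑ i ∈ Finset.range (k + 1), X i ≤
      (2 : ℝ) ^ (ms k + 1) • ∑ i ∈ Finset.range (ms k + 1), x (ns i) :=
    (smul_le_smul_of_nonneg_left h2 (by positivity)).trans
      (smul_le_smul_of_nonneg_right (pow_le_pow_right₀ one_le_two (by omega))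
        (Finset.sum_nonneg fun i _ => hpos _))
  have h4 := (hmono h3).trans (hsmall k).le
  have h5 : 1 / ((ms k : ℝ) + 1) ≤ 1 / ((k : ℝ) + 1) := by
    have : (k : ℝ) ≤ ms k := by exact_mod_cast hk
    gcongr
  change f (ns (ms (k + 1))) (X (k + 1)) ≤ _
  change _ ≤ f (ns (ms (k + 1))) (y (k + 1)) at h1
  linarith

end BanachLattice

/-! ### Positive multilinear forms -/

/-- Positive continuous multilinear forms map positive weakly null sequences to null sequences if
all but at most one of the Banach lattices have the weak Dunford-Pettis property. -/
theorem tendsto_multilinear_of_weakDunfordPettis {n : ℕ} : ∀ (E : Fin (n + 1) → Type u)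
    [∀ i, NormedAddCommGroup (E i)] [∀ i, NormedSpace ℝ (E i)] [∀ i, Lattice (E i)]
    [∀ i, IsOrderedAddMonoid (E i)] [∀ i, IsOrderedModule ℝ (E i)] [∀ i, HasSolidNorm (E i)]
    [∀ i, CompleteSpace (E i)], {i | ¬ WeakDunfordPettis (E i)}.Subsingleton →
    ∀ A : ContinuousMultilinearMap ℝ E ℝ, (∀ x, (∀ i, 0 ≤ x i) → 0 ≤ A x) →
    ∀ x : ∀ i, ℕ → E i, (∀ i j, 0 ≤ x i j) → (∀ i, WeaklyNull (x i)) →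
      Tendsto (fun j => A fun i => x i j) atTop (𝓝 0) := by
  induction n with
  | zero =>
    intro E _ _ _ _ _ _ _ _ A _ x _ hnull
    convert hnull 0 (A.toContinuousLinearMap 0 0) using 3 with j
    rw [ContinuousMultilinearMap.toContinuousLinearMap_apply]
    congr 1
    ext i
    obtain rfl : i = 0 := Subsingleton.elim (α := Fin 1) _ _
    simp
  | succ n ih =>
    intro E _ _ _ _ _ _ _ hE A hA x hpos hnull
    obtain ⟨p, hp⟩ : ∃ p, WeakDunfordPettis (E p) := by
      by_contra! h
      exact zero_ne_one (hE (h 0) (h 1))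
    let B := (A.curryMid p).flipMultilinear
    have hB : ∀ m v, B m v = A (p.insertNth v m) := fun _ _ => rfl
    have hBpos : ∀ m, (∀ i, 0 ≤ m i) → B m ∈ positiveFunctionals (E p) := fun m hm v hv => by
      rw [hB]
      refine hA _ fun i => ?_
      cases i using p.succAboveCases with
      | x => simpa using hv
      | p i => simpa using hm i
    -- The induction hypothesis is applied to the form `ψ ∘ B`, which is positive because `ψ`
    -- dominates `|φ|` on positive functionals.
    have hf : WeaklyNull fun j => B fun i => x (p.succAbove i) j := by
      intro φ
      obtain ⟨ψ, hψ⟩ := exists_dominating_functional (positiveFunctionals (E p))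
        (fun a ha b hb => norm_sub_le_norm_add_of_mem_positiveFunctionals ha hb) φ
      refine squeeze_zero_norm (fun j => hψ _ (hBpos _ fun i => hpos _ j)) ?_
      exact ih (fun i => E (p.succAbove i))
        (fun i hi k hk => Fin.succAbove_right_injective (hE hi hk))
        (ψ.compContinuousMultilinearMap B)
        (fun m hm => (abs_nonneg _).trans (hψ _ (hBpos m hm)))
        (fun i => x (p.succAbove i)) (fun i => hpos _) (fun i => hnull _)
    convert hp.tendsto_apply_of_nonneg hf (fun j => hBpos _ fun i => hpos _ j) (hnull p) (hpos p)
      using 2 with j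
    rw [hB]
    congr 1
    exact (p.insertNth_self_removeNth fun i => x i j).symm

/-! ### Elementary tensors and monotonicity of the norm -/

namespace RieszTensor

variable {ι : Type} {E : ι → Type u} [∀ i, NormedAddCommGroup (E i)] [∀ i, NormedSpace ℝ (E i)]
  [∀ i, Lattice (E i)]

/-- The elementary tensor as a multilinear map. -/
def tmulMultilinear : MultilinearMap ℝ E (RieszTensor E) where
  toFun := tmul
  map_update_add' m i a b := Subtype.ext (funext fun φ => φ.map.map_update_add m i a b)
  map_update_smul' m i c a := Subtype.ext (funext fun φ => φ.map.map_update_smul m i c a)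

variable [∀ i, IsOrderedAddMonoid (E i)]

theorem tmul_nonneg {x : ∀ i, E i} (hx : ∀ i, 0 ≤ x i) : 0 ≤ tmul x := by
  have h := abs_tmul x
  simp only [abs_of_nonneg (hx _)] at h
  exact h ▸ abs_nonneg _

variable [Fintype ι] [Nonempty ι] [∀ i, IsOrderedModule ℝ (E i)] [∀ i, HasSolidNorm (E i)]

theorem norm_tmul_le (x : ∀ i, E i) : ‖tmul x‖ ≤ ∏ i, ‖x i‖ :=
  csInf_le (bddBelow _) (tmul_mem x)

theorem norm_mono {v w : RieszTensor E} (h : |v| ≤ |w|) : ‖v‖ ≤ ‖w‖ :=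
  csInf_le_csInf (bddBelow _) (dominatingSums_nonempty w) fun _ => mem_mono h

theorem norm_sub_le_norm_add {a b : RieszTensor E} (ha : 0 ≤ a) (hb : 0 ≤ b) :
    ‖a - b‖ ≤ ‖a + b‖ := by
  refine norm_mono ?_
  rw [abs_of_nonneg (add_nonneg ha hb)]
  exact abs_le'.2 ⟨(sub_le_self a hb).trans (le_add_of_nonneg_right hb), by
    rw [neg_sub]
    exact (sub_le_self b ha).trans (le_add_of_nonneg_left ha)⟩

end RieszTensor

theorem mainTheorem7 {n : ℕ} [NeZero n] (E : Fin n → Type u)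
    [∀ i, NormedAddCommGroup (E i)] [∀ i, NormedSpace ℝ (E i)] [∀ i, Lattice (E i)]
    [∀ i, IsOrderedAddMonoid (E i)] [∀ i, IsOrderedModule ℝ (E i)] [∀ i, HasSolidNorm (E i)]
    [∀ i, CompleteSpace (E i)]
    (hE : {i | ¬ WeakDunfordPettis (E i)}.Subsingleton)
    (x : ∀ i, ℕ → E i) (hpos : ∀ i j, 0 ≤ x i j) (hnull : ∀ i, WeaklyNull (x i)) :
    WeaklyNull fun j => PositiveProjectiveTensor.tmul fun i => x i j := by
  intro φ
  -- Elementary tensors live before completion, so dominating the restriction of `φ` suffices and no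
  -- order on the completion is needed.
  obtain ⟨ψ, hψ⟩ := exists_dominating_functional (PointedCone.positive ℝ (RieszTensor E))
    (fun a ha b hb => RieszTensor.norm_sub_le_norm_add (by simpa using ha) (by simpa using hb))
    (φ.comp UniformSpace.Completion.toComplL)
  have hψ' : ∀ y : ∀ i, E i, (∀ i, 0 ≤ y i) →
      |φ (PositiveProjectiveTensor.tmul y)| ≤ ψ (RieszTensor.tmul y) := fun y hy =>
    hψ _ (by simpa using RieszTensor.tmul_nonneg hy)
  let A : ContinuousMultilinearMap ℝ E ℝ :=
    (ψ.toLinearMap.compMultilinearMap RieszTensor.tmulMultilinear).mkContinuous ‖ψ‖ fun y =>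
      (ψ.le_opNorm _).trans
        (mul_le_mul_of_nonneg_left (RieszTensor.norm_tmul_le y) (norm_nonneg ψ))
  have hA : ∀ y, (∀ i, 0 ≤ y i) → 0 ≤ A y := fun y hy => (abs_nonneg _).trans (hψ' y hy)
  refine squeeze_zero_norm (fun j => hψ' _ fun i => hpos i j) ?_
  obtain ⟨m, rfl⟩ := Nat.exists_eq_succ_of_ne_zero (NeZero.ne n)
  exact tendsto_multilinear_of_weakDunfordPettis E hE A hA x hpos hnull
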